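/- **Setting.** Let $\alpha>0$ be real and let $k,m,\kappa\ge 1$ be integers with $m\ge 2k$ ($k$ is the cache size, $m$ the number of pages, $\kappa$ the number of cores). For $1\le i\le m$ put $$p_i=\frac{1}{L(\alpha,m)}\cdot\frac1{i^{\alpha}},\quad L(\alpha,m)=\sum_{j=1}^m \frac1{j^{\alpha}},\qquad \tilde p_i=C\,\bigl(1-(1-p_i)^{\kappa}\bigr),$$ where $C$ is the constant with $\sum_{i=1}^m\tilde p_i=1$. For $q=p$ or $q=\tilde p$ and real $x,y$ let $q[x:y]$ be the sum of $q_i$ over the integers $i$ with $x\le i\le y$, and let $$F_{k,m}(q)=\min\left\{\frac{q[\frac{3k}{8}:\frac{k}{2}]+q[\frac{3k}{2}:m]}{q[\frac{3k}{8}:m]},\ \frac{q[\frac{11k}{8}:m]}{q[\frac{k}{2}:m]}\right\}.$$ For a paging algorithm ALG with cache size $k$, $$\mathrm{RoE}(\mathrm{ALG})=\limsup_{n\to\infty}\frac{\mathbb E[\mathrm{ALG}(\sigma)]}{\mathbb E[\mathrm{OPT}(\sigma)]},$$ where $\sigma$ is a sequence of $n$ independent requests with distribution $\tilde p$, $\mathrm{ALG}(\sigma)$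 is the cost of ALG on $\sigma$, and $\mathrm{OPT}(\sigma)$ is the least number of pages brought into the cache by any offline schedule (starting from an empty cache) that holds at most $k$ pages at any time and holds each requested page while it is processed. LRU starts from an empty cache, evicts the least recently requested page at a page fault when the cache is full, and pays $1$ per fault. PLFU (Perfect LFU) holds the $k$ most frequent among all pages between requests, and pays $2$ per fault (the $k$-th most popular page is evicted for the requested page and is added back right after the request). Here "frequent" refers either to the probabilities $\tilde p_i$ or to the numbers of requests seen so far, ties being broken by an arbitrary fixed order of the pages; the claims hold for both versions. **Claims.** 1. For every integer $\kappa\ge1$ and every real $x$ with $0\le x\le 1/\kappa$, $$\kappa x\ \ge\ 1-(1-x)^{\kappa}\ \ge\ \frac{\kappa x}{1+\kappa x}\ \ge\ \frac{\kappa x}{2}.$$ 2. For all $\alpha>0$ and all integers $k,\kappa\ge 1$, $m\ge 2k$: $\ F_{k,m}(\tilde p)\ge\frac12F_{k,m}(p)$. 3. For every $\alpha>0$ there is $\delta>0$, depending only on $\alpha$, such that $F_{k,m}(\tilde p)\ge\delta$ for all integers $k,\kappa\ge 1$, $m\ge 2k$. 4. For every $\alpha>0$ there is a finite constant $c$, depending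 only on $\alpha$, such that for all integers $k,\kappa\ge 1$, $m\ge 2k$: $\ \mathrm{RoE}(\mathrm{LRU})\le c$ and $\mathrm{RoE}(\mathrm{PLFU})\le c$. -/

import Mathlib

open scoped NNReal ENNReal

namespace Paging

/-! ### Page probabilities.  Pages are numbered `1, …, m` by decreasing probability. -/

/-- Power-law probability of page `i ∈ {1, …, m}`: `p_i = (1 / L(α, m)) * (1 / i ^ α)` with
`L(α, m) = ∑_{j=1}^m 1 / j ^ α`. -/
noncomputable def powerLaw (α : ℝ) (m : ℕ) (i : ℕ) : ℝ :=
  (1 / ∑ j ∈ Finset.Icc 1 m, 1 / (j : ℝ) ^ α) * (1 / (i : ℝ) ^ α)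

/-- Multi-core power-law probability of page `i ∈ {1, …, m}` with `κ` cores:
`C * (1 - (1 - p_i) ^ κ)`, where `C` makes the probabilities sum to one. -/
noncomputable def multiCore (α : ℝ) (m κ : ℕ) (i : ℕ) : ℝ :=
  (1 / ∑ j ∈ Finset.Icc 1 m, (1 - (1 - powerLaw α m j) ^ κ)) * (1 - (1 - powerLaw α m i) ^ κ)

/-- `p[x:y]`, the sum of `p i` over the integers `i` with `x ≤ i ≤ y`. -/
noncomputable def blockSum (p : ℕ → ℝ) (x y : ℝ) : ℝ :=
  ∑ i ∈ Finset.Icc ⌈x⌉₊ ⌊y⌋₊, p i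

/-- The expression
`min ((p[3k/8:k/2] + p[3k/2:m]) / p[3k/8:m]) (p[11k/8:m] / p[k/2:m])`. -/
noncomputable def minExpr (p : ℕ → ℝ) (k m : ℕ) : ℝ :=
  min ((blockSum p (3 * k / 8) (k / 2) + blockSum p (3 * k / 2) m) / blockSum p (3 * k / 8) m)
    (blockSum p (11 * k / 8) m / blockSum p (k / 2) m)

/-! ### Paging costs.  The pages are a type `P`, later `Fin m`; requests are `σ : Fin n → P`. -/

section Costs

variable {P : Type*} [DecidableEq P]

/-- Page faults of LRU with cache size `k` on a list of requests, when the cache holds the pages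
of the list `c`, ordered from the most to the least recently requested. -/
def lruFaults (k : ℕ) : List P → List P → ℕ
  | _, [] => 0
  | c, r :: σ => (if r ∈ c then 0 else 1) + lruFaults k ((r :: c.erase r).take k) σ

/-- Cost of LRU with cache size `k`, starting from an empty cache. -/
def lruCost (k : ℕ) (n : ℕ) (σ : Fin n → P) : ℕ :=
  lruFaults k [] (List.ofFn σ)

/-- `C` is a feasible sequence of cache contents for the requests `σ`: the cache is empty at the
start, never holds more than `k` pages, and holds the requested page while it is processed. -/
def IsSchedule (k : ℕ) {n : ℕ} (σ : Fin n → P) (C : ℕ → Finset P) : Prop :=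
  C 0 = ∅ ∧ (∀ t, (C t).card ≤ k) ∧ ∀ t : Fin n, σ t ∈ C (t + 1)

/-- Number of pages brought into the cache by the schedule `C` during the first `n` requests. -/
def scheduleCost (n : ℕ) (C : ℕ → Finset P) : ℕ :=
  ∑ t ∈ Finset.range n, (C (t + 1) \ C t).card

/-- Cost of the offline optimum: the least cost of a feasible schedule. -/
noncomputable def optCost (k : ℕ) (n : ℕ) (σ : Fin n → P) : ℕ :=
  sInf {c : ℕ | ∃ C : ℕ → Finset P, IsSchedule k σ C ∧ scheduleCost n C = c}

end Costs

/-- The `k` pages with the largest frequency `w`; ties are broken in the order `τ`. -/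
def mostFrequent {m : ℕ} {R : Type*} [LinearOrder R] (w : Fin m → R) (τ : Equiv.Perm (Fin m))
    (k : ℕ) : Finset (Fin m) :=
  Finset.univ.filter fun i =>
    (Finset.univ.filter fun j => w i < w j ∨ (w i = w j ∧ τ j < τ i)).card < k

/-- Cost of Perfect LFU with respect to the page probabilities `q`: between requests the cache
holds the `k` most probable pages; every page fault costs two (the `k`-th most popular page is
evicted for the requested page and is added back right after the request). -/
noncomputable def plfuCost {m : ℕ} (q : Fin m → ℝ) (τ : Equiv.Perm (Fin m)) (k : ℕ)
    (n : ℕ) (σ : Fin n → Fin m) : ℕ :=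
  2 * (Finset.univ.filter fun t => σ t ∉ mostFrequent q τ k).card

/-- Number of requests to page `i` before time `t`. -/
def countBefore {m n : ℕ} (σ : Fin n → Fin m) (t : Fin n) (i : Fin m) : ℕ :=
  (Finset.univ.filter fun s => s < t ∧ σ s = i).card

/-- Cost of Perfect LFU with observed frequencies: before each request the cache holds the `k`
pages that were requested most often so far (over all pages); every page fault costs two. -/
def countingPlfuCost {m : ℕ} (τ : Equiv.Perm (Fin m)) (k : ℕ) (n : ℕ) (σ : Fin n → Fin m) : ℕ :=
  2 * (Finset.univ.filter fun t => σ t ∉ mostFrequent (countBefore σ t) τ k).card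

/-! ### Ratio of expectations -/

/-- Expectation of `f` over `n` independent requests, each equal to page `i` with
probability `q i`. -/
noncomputable def expectation {m : ℕ} (q : Fin m → ℝ) (n : ℕ) (f : (Fin n → Fin m) → ℕ) : ℝ :=
  ∑ σ : Fin n → Fin m, (∏ t, q (σ t)) * (f σ : ℝ)

/-- `RoE(ALG) = limsup_{n → ∞} E[ALG(σ)] / E[OPT(σ)]` for cache size `k`, as an extended
nonnegative real. -/
noncomputable def RoE {m : ℕ} (q : Fin m → ℝ) (k : ℕ)
    (ALG : ∀ n : ℕ, (Fin n → Fin m) → ℕ) : ℝ≥0∞ :=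
  Filter.limsup (fun n : ℕ => ENNReal.ofReal (expectation q n (ALG n)) /
    ENNReal.ofReal (expectation q n (optCost k n))) Filter.atTop

/-- The multi-core power-law distribution on `Fin m`; `i : Fin m` stands for page `i + 1`. -/
noncomputable def multiCoreDist (α : ℝ) (m κ : ℕ) (i : Fin m) : ℝ :=
  multiCore α m κ (i + 1)

end Paging

/-! ### Elementary bounds for `1 - (1 - x) ^ κ`. -/

namespace Paging

/-! Passing from `p` to the multi-core law flattens the distribution: `(1 - (1 - x) ^ κ) / x`
decreases in `x`, so the ratio of the two laws grows with the page number. Hence the second argument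
of the minimum, `tailRatio`, does not decrease (`tailRatio_le_tailRatio`). For every positive
decreasing law the first argument is at least half the second (`half_tailRatio_le_minExpr`), which
gives the factor 1/2. Flattening also bounds the ratio of the probabilities of pages between `k/2`
and `2k` by `4 ^ α`, so `tailRatio` is bounded below uniformly (`inv_le_tailRatio`).

For the ratios of expectations, let `U` be the mass outside the top `⌊k/2⌋` pages. LRU is
2-competitive against that static set (`lruCost_le`), and PLFU faults only on pages outside the top
`k`, up to a bounded expected number of times if it counts frequencies; so both cost at most `2nU +
O(1)` as `n` grows. A window of requests with `D` distinct pages costs OPT at least `D - k`. The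
shortest window with `3k/2` expected distinct pages has only `O(k)` expected requests outside the
top `⌊k/2⌋` (`exists_window`), so OPT costs a constant fraction of `nU`. -/

theorem mul_div_one_add_mul_le_one_sub_one_sub_pow (κ : ℕ) {x : ℝ} (h0 : 0 ≤ x) (h1 : x ≤ 1) :
    κ * x / (1 + κ * x) ≤ 1 - (1 - x) ^ κ := by
  have hpos : 0 < 1 + κ * x := by positivity
  have hB : 1 + κ * x ≤ (1 + x) ^ κ := one_add_mul_le_pow (by linarith) κ
  -- The product is `(1 - x²) ^ κ`; together with Bernoulli this needs only `x ≤ 1`, which later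
  -- uses rely on.
  have hP : (1 - x) ^ κ * (1 + x) ^ κ ≤ 1 := by
    rw [← mul_pow]
    exact pow_le_one₀ (mul_nonneg (by linarith) (by linarith)) (by nlinarith)
  have hm : (1 - x) ^ κ * (1 + κ * x) ≤ 1 :=
    (mul_le_mul_of_nonneg_left hB (pow_nonneg (by linarith) κ)).trans hP
  rw [div_le_iff₀ hpos]
  linarith

theorem one_sub_one_sub_pow_bounds (κ : ℕ) (x : ℝ) (hκ : 1 ≤ κ) (h0 : 0 ≤ x)
    (hx : x ≤ 1 / (κ : ℝ)) :
    κ * x ≥ 1 - (1 - x) ^ κ ∧ 1 - (1 - x) ^ κ ≥ κ * x / (1 + κ * x) ∧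
      κ * x / (1 + κ * x) ≥ κ * x / 2 := by
  have hκ' : (1 : ℝ) ≤ κ := by exact_mod_cast hκ
  have hκx : κ * x ≤ 1 := by
    rw [le_div_iff₀ (by linarith)] at hx
    linarith
  have hx1 : x ≤ 1 := by nlinarith
  refine ⟨?_, mul_div_one_add_mul_le_one_sub_one_sub_pow κ h0 hx1, ?_⟩
  · have := one_add_mul_le_pow (a := -x) (by linarith) κ
    rw [← sub_eq_add_neg] at this
    linarith
  · have : 0 ≤ κ * x := by positivity
    exact div_le_div_of_nonneg_left this (by linarith) (by linarith)

/-- `(1 - (1 - x) ^ κ) / x` is antitone on `(0, 1]`. -/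
theorem one_sub_one_sub_pow_mul_le (κ : ℕ) {x y : ℝ} (hy : 0 ≤ y) (hyx : y ≤ x) (hx : x ≤ 1) :
    (1 - (1 - x) ^ κ) * y ≤ (1 - (1 - y) ^ κ) * x := by
  -- After the factor `z` is split off, the remaining geometric sum decreases term by term in `z`.
  have key (z : ℝ) : 1 - (1 - z) ^ κ = z * ∑ l ∈ Finset.range κ, (1 - z) ^ l := by
    have := mul_neg_geom_sum (1 - z) κ
    rw [← this]
    ring
  rw [key x, key y]
  have : ∑ l ∈ Finset.range κ, (1 - x) ^ l ≤ ∑ l ∈ Finset.range κ, (1 - y) ^ l :=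
    Finset.sum_le_sum fun l _ => pow_le_pow_left₀ (by linarith) (by linarith) l
  have := mul_le_mul_of_nonneg_left this (mul_nonneg (hy.trans hyx) hy)
  linarith

/-! ### The power law and its multi-core version. -/

section PowerLaw

variable {α : ℝ} {m : ℕ}

theorem sum_one_div_rpow_pos (α : ℝ) (hm : 1 ≤ m) :
    0 < ∑ j ∈ Finset.Icc 1 m, 1 / (j : ℝ) ^ α := by
  refine Finset.sum_pos (fun j hj => ?_) ⟨1, by simpa using hm⟩
  have : (0 : ℝ) < j := by exact_mod_cast (Finset.mem_Icc.1 hj).1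
  positivity

theorem powerLaw_pos (α : ℝ) (hm : 1 ≤ m) {i : ℕ} (hi : 1 ≤ i) : 0 < powerLaw α m i := by
  have := sum_one_div_rpow_pos α hm
  have : (0 : ℝ) < i := by exact_mod_cast hi
  unfold powerLaw
  positivity

theorem powerLaw_lt_powerLaw (hα : 0 < α) (hm : 1 ≤ m) {i j : ℕ} (hi : 1 ≤ i) (hij : i < j) :
    powerLaw α m j < powerLaw α m i := by
  have := sum_one_div_rpow_pos α hm
  have hi' : (0 : ℝ) < i := by exact_mod_cast hi
  have hij' : (i : ℝ) < j := by exact_mod_cast hij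
  unfold powerLaw
  refine mul_lt_mul_of_pos_left ?_ (by positivity)
  exact one_div_lt_one_div_of_lt (by positivity) (Real.rpow_lt_rpow hi'.le hij' hα)

theorem powerLaw_le_one (hα : 0 < α) (hm : 1 ≤ m) {i : ℕ} (hi : 1 ≤ i) :
    powerLaw α m i ≤ 1 := by
  have h1 : powerLaw α m 1 ≤ 1 := by
    have hp := sum_one_div_rpow_pos α hm
    unfold powerLaw
    rw [one_div_mul_eq_div, div_le_one hp]
    exact Finset.single_le_sum (f := fun j : ℕ => 1 / (j : ℝ) ^ α)
      (fun j _ => by positivity) (by simpa using hm)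
  rcases hi.eq_or_lt with rfl | h
  · exact h1
  · exact (powerLaw_lt_powerLaw hα hm le_rfl h).le.trans h1

theorem powerLaw_eq_div_rpow_mul {i j : ℕ} (hi : 1 ≤ i) (hj : 1 ≤ j) :
    powerLaw α m i = ((j : ℝ) / i) ^ α * powerLaw α m j := by
  have hi' : (0 : ℝ) < i := by exact_mod_cast hi
  have hj' : (0 : ℝ) < j := by exact_mod_cast hj
  unfold powerLaw
  rw [Real.div_rpow hj'.le hi'.le]
  have := Real.rpow_pos_of_pos hj' α
  field_simp

theorem one_sub_one_sub_powerLaw_pow_lt (hα : 0 < α) (hm : 1 ≤ m) {κ : ℕ} (hκ : 1 ≤ κ) {i j : ℕ}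
    (hi : 1 ≤ i) (hij : i < j) :
    1 - (1 - powerLaw α m j) ^ κ < 1 - (1 - powerLaw α m i) ^ κ := by
  have h1 := powerLaw_lt_powerLaw hα hm hi hij
  have h2 := powerLaw_le_one hα hm hi
  have := pow_lt_pow_left₀ (a := 1 - powerLaw α m i) (b := 1 - powerLaw α m j)
    (by linarith) (by linarith) (n := κ) (by omega)
  linarith

theorem one_sub_one_sub_powerLaw_pow_pos (hα : 0 < α) (hm : 1 ≤ m) {κ : ℕ} (hκ : 1 ≤ κ) {i : ℕ}
    (hi : 1 ≤ i) : 0 < 1 - (1 - powerLaw α m i) ^ κ := by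
  have h1 := powerLaw_pos α hm hi
  have h2 := powerLaw_le_one hα hm hi
  have := pow_lt_one₀ (a := 1 - powerLaw α m i) (by linarith) (by linarith) (n := κ) (by omega)
  linarith

theorem sum_one_sub_one_sub_powerLaw_pow_pos (hα : 0 < α) (hm : 1 ≤ m) {κ : ℕ} (hκ : 1 ≤ κ) :
    0 < ∑ j ∈ Finset.Icc 1 m, (1 - (1 - powerLaw α m j) ^ κ) :=
  Finset.sum_pos (fun _ hj => one_sub_one_sub_powerLaw_pow_pos hα hm hκ (Finset.mem_Icc.1 hj).1)
    ⟨1, by simpa using hm⟩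

variable {κ : ℕ}

theorem multiCore_pos (hα : 0 < α) (hm : 1 ≤ m) (hκ : 1 ≤ κ) {i : ℕ} (hi : 1 ≤ i) :
    0 < multiCore α m κ i := by
  exact mul_pos (one_div_pos.2 (sum_one_sub_one_sub_powerLaw_pow_pos hα hm hκ))
    (one_sub_one_sub_powerLaw_pow_pos hα hm hκ hi)

theorem multiCore_lt_multiCore (hα : 0 < α) (hm : 1 ≤ m) (hκ : 1 ≤ κ) {i j : ℕ} (hi : 1 ≤ i)
    (hij : i < j) : multiCore α m κ j < multiCore α m κ i := by
  have := sum_one_sub_one_sub_powerLaw_pow_pos hα hm hκ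
  exact mul_lt_mul_of_pos_left (one_sub_one_sub_powerLaw_pow_lt hα hm hκ hi hij) (by positivity)

theorem multiCore_le_multiCore (hα : 0 < α) (hm : 1 ≤ m) (hκ : 1 ≤ κ) {i j : ℕ} (hi : 1 ≤ i)
    (hij : i ≤ j) : multiCore α m κ j ≤ multiCore α m κ i := by
  rcases hij.eq_or_lt with rfl | h
  · exact le_rfl
  · exact (multiCore_lt_multiCore hα hm hκ hi h).le

theorem sum_multiCore (hα : 0 < α) (hm : 1 ≤ m) (hκ : 1 ≤ κ) :
    ∑ i ∈ Finset.Icc 1 m, multiCore α m κ i = 1 := by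
  have := sum_one_sub_one_sub_powerLaw_pow_pos hα hm hκ
  unfold multiCore
  rw [← Finset.mul_sum, one_div_mul_cancel this.ne']

/-- Cross-multiplied form of the flattening: multi-core over power law is nondecreasing in the page
number. -/
theorem multiCore_mul_powerLaw_le (hα : 0 < α) (hm : 1 ≤ m) (hκ : 1 ≤ κ) {i j : ℕ} (hi : 1 ≤ i)
    (hij : i ≤ j) :
    multiCore α m κ i * powerLaw α m j ≤ multiCore α m κ j * powerLaw α m i := by
  have h0 := sum_one_sub_one_sub_powerLaw_pow_pos hα hm hκ
  have h1 : powerLaw α m j ≤ powerLaw α m i := by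
    rcases hij.eq_or_lt with rfl | h
    · exact le_rfl
    · exact (powerLaw_lt_powerLaw hα hm hi h).le
  unfold multiCore
  rw [mul_assoc, mul_assoc]
  exact mul_le_mul_of_nonneg_left (one_sub_one_sub_pow_mul_le κ
    (powerLaw_pos α hm (hi.trans hij)).le h1 (powerLaw_le_one hα hm hi)) (by positivity)

/-- By flattening, multi-core ratios are at most the power-law ratios `(j / i) ^ α`, whatever `κ`
and `m` are. -/
theorem multiCore_le_rpow_mul (hα : 0 < α) (hm : 1 ≤ m) (hκ : 1 ≤ κ) {i j : ℕ} (hi : 1 ≤ i)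
    (hij : i ≤ j) {c : ℝ} (hc : (j : ℝ) ≤ c * i) :
    multiCore α m κ i ≤ c ^ α * multiCore α m κ j := by
  have hi' : (0 : ℝ) < i := by exact_mod_cast hi
  have h := multiCore_mul_powerLaw_le hα hm hκ hi hij
  have hp := powerLaw_pos α hm (hi.trans hij)
  have hq := multiCore_pos hα hm hκ (hi.trans hij)
  rw [powerLaw_eq_div_rpow_mul hi (hi.trans hij), ← mul_assoc] at h
  have h' := le_of_mul_le_mul_right h hp
  have : ((j : ℝ) / i) ^ α ≤ c ^ α :=
    Real.rpow_le_rpow (by positivity) ((div_le_iff₀ hi').2 hc) hα.le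
  nlinarith

end PowerLaw

/-! ### Block sums and the minimum expression. -/

section Blocks

theorem blockSum_natCast (p : ℕ → ℝ) (x : ℝ) (m : ℕ) :
    blockSum p x m = ∑ i ∈ Finset.Icc ⌈x⌉₊ m, p i := by
  rw [blockSum, Nat.floor_natCast]

/-- Turns the real block boundaries into integer inequalities that `omega` can use. -/
theorem ceil_mul_div_bounds (k a b : ℕ) (hb : 0 < b) :
    a * k ≤ b * ⌈(a * k / b : ℝ)⌉₊ ∧ b * ⌈(a * k / b : ℝ)⌉₊ < a * k + b := by
  have hb' : (0 : ℝ) < b := by exact_mod_cast hb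
  have h1 := Nat.le_ceil (a * k / b : ℝ)
  have h2 := Nat.ceil_lt_add_one (a := (a * k / b : ℝ)) (by positivity)
  rw [div_le_iff₀ hb'] at h1
  rw [← sub_lt_iff_lt_add, lt_div_iff₀ hb'] at h2
  constructor
  · have : (a * k : ℝ) ≤ b * ⌈(a * k / b : ℝ)⌉₊ := by linarith
    exact_mod_cast this
  · have : (b * ⌈(a * k / b : ℝ)⌉₊ : ℝ) < a * k + b := by linarith
    exact_mod_cast this

theorem sum_Icc_eq_sum_Ico_add (p : ℕ → ℝ) {a b m : ℕ} (hab : a ≤ b) (hb : b ≤ m + 1) :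
    ∑ i ∈ Finset.Icc a m, p i = ∑ i ∈ Finset.Ico a b, p i + ∑ i ∈ Finset.Icc b m, p i := by
  have e (c : ℕ) : Finset.Icc c m = Finset.Ico c (m + 1) := by
    ext; simp
  rw [e, e, Finset.sum_Ico_consecutive _ hab hb]

/-- The second argument of the minimum in `minExpr`. -/
noncomputable def tailRatio (p : ℕ → ℝ) (k m : ℕ) : ℝ :=
  blockSum p (11 * k / 8) m / blockSum p (k / 2) m

theorem exists_tailRatio_eq {k m : ℕ} (hk : 1 ≤ k) (hm : 2 * k ≤ m) :
    ∃ a b : ℕ, 1 ≤ a ∧ k ≤ 2 * a ∧ 2 * a < k + 2 ∧ 11 * k ≤ 8 * b ∧ 8 * b < 11 * k + 8 ∧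
      ∀ p : ℕ → ℝ, tailRatio p k m = (∑ i ∈ Finset.Icc b m, p i) /
        (∑ i ∈ Finset.Ico a b, p i + ∑ i ∈ Finset.Icc b m, p i) := by
  have h1 := ceil_mul_div_bounds k 1 2 (by norm_num)
  have h2 := ceil_mul_div_bounds k 11 8 (by norm_num)
  norm_num only [Nat.cast_ofNat, Nat.cast_one, one_mul] at h1 h2
  refine ⟨⌈(k / 2 : ℝ)⌉₊, ⌈(11 * k / 8 : ℝ)⌉₊, by omega, h1.1, h1.2, h2.1, h2.2, fun p => ?_⟩
  rw [tailRatio, blockSum_natCast, blockSum_natCast,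
    sum_Icc_eq_sum_Ico_add p (a := ⌈(k / 2 : ℝ)⌉₊) (b := ⌈(11 * k / 8 : ℝ)⌉₊) (by omega)
      (by omega)]

variable {p q : ℕ → ℝ} {k m : ℕ}

/-- Each side has the form `N / (M + N)`, which increases with `N / M`. Expanding the cross products
into double sums, the hypothesis applies to each pair of a page before the cut and a page after it.
-/
theorem tailRatio_le_tailRatio (hk : 1 ≤ k) (hm : 2 * k ≤ m) (hp : ∀ i, 1 ≤ i → 0 < p i)
    (hq : ∀ i, 1 ≤ i → 0 < q i) (h : ∀ i j, 1 ≤ i → i ≤ j → q i * p j ≤ q j * p i) :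
    tailRatio p k m ≤ tailRatio q k m := by
  obtain ⟨a, b, ha, h1, h2, h3, h4, e⟩ := exists_tailRatio_eq hk hm
  have pos {r : ℕ → ℝ} (hr : ∀ i, 1 ≤ i → 0 < r i) : 0 < ∑ i ∈ Finset.Icc b m, r i ∧
      0 ≤ ∑ i ∈ Finset.Ico a b, r i := by
    constructor
    · exact Finset.sum_pos (fun i hi => hr i (by have := (Finset.mem_Icc.1 hi).1; omega))
        ⟨b, Finset.mem_Icc.2 ⟨le_rfl, by omega⟩⟩
    · exact Finset.sum_nonneg fun i hi => (hr i (by have := (Finset.mem_Ico.1 hi).1; omega)).le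
  obtain ⟨p1, p2⟩ := pos hp
  obtain ⟨q1, q2⟩ := pos hq
  have key : (∑ i ∈ Finset.Ico a b, q i) * (∑ i ∈ Finset.Icc b m, p i) ≤
      (∑ i ∈ Finset.Icc b m, q i) * (∑ i ∈ Finset.Ico a b, p i) := by
    rw [mul_comm (∑ i ∈ Finset.Icc b m, q i), Finset.sum_mul_sum, Finset.sum_mul_sum]
    refine Finset.sum_le_sum fun i hi => Finset.sum_le_sum fun j hj => ?_
    rw [Finset.mem_Ico] at hi
    rw [Finset.mem_Icc] at hj
    exact (h i j (by omega) (by omega)).trans (mul_comm _ _).le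
  rw [e, e, div_le_div_iff₀ (by linarith) (by linarith)]
  linarith

/-- Shifting by `k` carries the block from `11k/8` to `3k/2` into the block from `3k/8` to `k/2`,
where the mass is larger. So the first numerator is at least the second numerator, and the rest is
bookkeeping with the denominators. -/
theorem half_tailRatio_le_minExpr (hk : 1 ≤ k) (hm : 2 * k ≤ m) (hq : ∀ i, 1 ≤ i → 0 < q i)
    (hanti : ∀ i j, 1 ≤ i → i ≤ j → q j ≤ q i) : tailRatio q k m / 2 ≤ minExpr q k m := by
  have h1 := ceil_mul_div_bounds k 1 2 (by norm_num)
  have h2 := ceil_mul_div_bounds k 11 8 (by norm_num)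
  have h3 := ceil_mul_div_bounds k 3 8 (by norm_num)
  have h4 := ceil_mul_div_bounds k 3 2 (by norm_num)
  norm_num only [Nat.cast_ofNat, Nat.cast_one, one_mul] at h1 h2 h3 h4
  have hf : ⌊(k / 2 : ℝ)⌋₊ = k / 2 := by
    have := Nat.floor_div_natCast (k : ℝ) 2
    simpa using this
  have nn (s t : ℕ) (hs : 1 ≤ s) : 0 ≤ ∑ i ∈ Finset.Icc s t, q i :=
    Finset.sum_nonneg fun i hi => (hq i (hs.trans (Finset.mem_Icc.1 hi).1)).le
  have hT : 0 ≤ tailRatio q k m := by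
    rw [tailRatio, blockSum_natCast, blockSum_natCast]
    exact div_nonneg (nn _ _ (by omega)) (nn _ _ (by omega))
  rw [minExpr, ← tailRatio, le_min_iff]
  refine ⟨?_, by linarith⟩
  rw [tailRatio, blockSum_natCast, blockSum_natCast, blockSum_natCast, blockSum_natCast, blockSum,
    hf]
  set a := ⌈(k / 2 : ℝ)⌉₊
  set b := ⌈(11 * k / 8 : ℝ)⌉₊
  set a0 := ⌈(3 * k / 8 : ℝ)⌉₊
  set d := ⌈(3 * k / 2 : ℝ)⌉₊
  have eA : ∑ i ∈ Finset.Icc a0 m, q i =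
      ∑ i ∈ Finset.Icc a0 (k / 2), q i + ∑ i ∈ Finset.Icc (k / 2 + 1) m, q i := by
    rw [sum_Icc_eq_sum_Ico_add q (a := a0) (b := k / 2 + 1) (by omega) (by omega)]
    congr 2
  have eb := sum_Icc_eq_sum_Ico_add q (a := b) (b := d) (m := m) (by omega) (by omega)
  have hRN := sum_Icc_eq_sum_Ico_add q (a := k / 2 + 1) (b := b) (m := m) (by omega) (by omega)
  have hQR := sum_Icc_eq_sum_Ico_add q (a := a) (b := k / 2 + 1) (m := m) (by omega) (by omega)
  have nn' (s t : ℕ) (hs : 1 ≤ s) : 0 ≤ ∑ i ∈ Finset.Ico s t, q i :=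
    Finset.sum_nonneg fun i hi => (hq i (hs.trans (Finset.mem_Ico.1 hi).1)).le
  have i1 := nn' (k / 2 + 1) b (by omega)
  have i2 := nn' a (k / 2 + 1) (by omega)
  have i3 := nn d m (by omega)
  have i4 := nn' b d (by omega)
  have i5 := nn a0 (k / 2) (by omega)
  have hbA : ∑ i ∈ Finset.Ico b d, q i ≤ ∑ i ∈ Finset.Icc a0 (k / 2), q i := by
    calc ∑ i ∈ Finset.Ico b d, q i ≤ ∑ i ∈ Finset.Ico b d, q (i - k) := by
          refine Finset.sum_le_sum fun i hi => hanti _ _ ?_ (by omega)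
          have := (Finset.mem_Ico.1 hi).1
          omega
      _ = ∑ i ∈ (Finset.Ico b d).image (· - k), q i := by
          rw [Finset.sum_image]
          intro x hx y hy hxy
          simp only [Finset.coe_Ico, Set.mem_Ico] at hx hy hxy
          omega
      _ ≤ _ := by
          refine Finset.sum_le_sum_of_subset_of_nonneg ?_ fun i hi _ => (hq i ?_).le
          · intro i hi
            simp only [Finset.mem_image, Finset.mem_Ico] at hi
            rw [Finset.mem_Icc]
            omega
          · have := (Finset.mem_Icc.1 hi).1
            omega
  have hNpos : 0 < ∑ i ∈ Finset.Icc b m, q i :=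
    Finset.sum_pos (fun i hi => hq i (by have := (Finset.mem_Icc.1 hi).1; omega))
      ⟨b, Finset.mem_Icc.2 ⟨le_rfl, by omega⟩⟩
  rw [eA]
  generalize ∑ i ∈ Finset.Icc b m, q i = N at *
  generalize ∑ i ∈ Finset.Icc d m, q i = D at *
  generalize ∑ i ∈ Finset.Ico b d, q i = B at *
  generalize ∑ i ∈ Finset.Icc a0 (k / 2), q i = A at *
  generalize ∑ i ∈ Finset.Icc (k / 2 + 1) m, q i = R at *
  generalize ∑ i ∈ Finset.Icc a m, q i = Q at *
  have hR : N ≤ R := by linarith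
  have hQ : R ≤ Q := by linarith
  rw [div_div, div_le_div_iff₀ (by linarith) (by linarith)]
  -- With `N = B + D`, the difference `2 * Q * (A + D) - N * (A + R)` equals `t1 + t2 + t3 + 2 *
  -- t4`.
  have t1 : 0 ≤ A * (R - N) := mul_nonneg i5 (by linarith)
  have t2 : 0 ≤ R * (A - B) := mul_nonneg (by linarith) (by linarith)
  have t3 : 0 ≤ D * R := mul_nonneg i3 (by linarith)
  have t4 : 0 ≤ (A + D) * (Q - R) := mul_nonneg (by linarith) (by linarith)
  subst eb
  linarith

/-- Page `2k` is the yardstick: the block before the cut has at most `2k` pages of mass at most `K *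
q (2 * k)`, and at least `k/2` pages between the cut and `2k` have mass at least `q (2 * k)`. -/
theorem inv_le_tailRatio (hk : 1 ≤ k) (hm : 2 * k ≤ m) {K : ℝ} (hq : ∀ i, 1 ≤ i → 0 < q i)
    (hanti : ∀ i j, 1 ≤ i → i ≤ j → q j ≤ q i)
    (hK : ∀ i, k ≤ 2 * i → i ≤ 2 * k → q i ≤ K * q (2 * k)) :
    1 / (1 + 4 * K) ≤ tailRatio q k m := by
  obtain ⟨a, b, ha, h1, h2, h3, h4, e⟩ := exists_tailRatio_eq hk hm
  have hq2 := hq (2 * k) (by omega)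
  have hKpos : 0 < K := by
    by_contra! h
    have := hK (2 * k) (by omega) le_rfl
    nlinarith
  have hB : ∑ i ∈ Finset.Ico a b, q i ≤ (2 * k : ℕ) * (K * q (2 * k)) := by
    calc ∑ i ∈ Finset.Ico a b, q i ≤ (Finset.Ico a b).card • (K * q (2 * k)) := by
          refine Finset.sum_le_card_nsmul _ _ _ fun i hi => ?_
          rw [Finset.mem_Ico] at hi
          exact hK i (by omega) (by omega)
      _ ≤ _ := by
          rw [nsmul_eq_mul, Nat.card_Ico]
          refine mul_le_mul_of_nonneg_right ?_ (by positivity)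
          exact_mod_cast (by omega : b - a ≤ 2 * k)
  have hN : ((2 * k + 1 - b : ℕ) : ℝ) * q (2 * k) ≤ ∑ i ∈ Finset.Icc b m, q i := by
    calc ((2 * k + 1 - b : ℕ) : ℝ) * q (2 * k) = (Finset.Icc b (2 * k)).card • q (2 * k) := by
          rw [nsmul_eq_mul, Nat.card_Icc]
      _ ≤ ∑ i ∈ Finset.Icc b (2 * k), q i := by
          refine Finset.card_nsmul_le_sum _ _ _ fun i hi => ?_
          rw [Finset.mem_Icc] at hi
          exact hanti _ _ (by omega) hi.2
      _ ≤ _ := by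
          refine Finset.sum_le_sum_of_subset_of_nonneg (Finset.Icc_subset_Icc_right hm)
            fun i hi _ => (hq i ?_).le
          have := (Finset.mem_Icc.1 hi).1
          omega
  have hc : ((2 * k : ℕ) : ℝ) ≤ 4 * ((2 * k + 1 - b : ℕ) : ℝ) := by
    exact_mod_cast (by omega : 2 * k ≤ 4 * (2 * k + 1 - b))
  have hcpos : (0 : ℝ) < ((2 * k + 1 - b : ℕ) : ℝ) := by
    exact_mod_cast (by omega : 0 < 2 * k + 1 - b)
  have hNpos : 0 < ∑ i ∈ Finset.Icc b m, q i := lt_of_lt_of_le (by positivity) hN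
  have hBnn : 0 ≤ ∑ i ∈ Finset.Ico a b, q i :=
    Finset.sum_nonneg fun i hi => (hq i (by have := (Finset.mem_Ico.1 hi).1; omega)).le
  have hBN : ∑ i ∈ Finset.Ico a b, q i ≤ 4 * K * ∑ i ∈ Finset.Icc b m, q i := by
    have s1 := mul_le_mul_of_nonneg_right hc (mul_pos hKpos hq2).le
    have s2 := mul_le_mul_of_nonneg_left hN (mul_pos four_pos hKpos).le
    linarith
  rw [e, div_le_div_iff₀ (by linarith) (by linarith)]
  linarith

end Blocks

end Paging

namespace Paging

/-! ### LRU against a static set of pages. -/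

section LRU

variable {P : Type*} [DecidableEq P]

/-- The number of pages outside `H` that precede `r` in the cache list, truncated at `s`;
it is `s` if `r` is not in the list. -/
def lruPotential (H : Finset P) (s : ℕ) (r : P) : List P → ℕ
  | [] => s
  | x :: c => if x = r then 0 else
      if x ∈ H then lruPotential H s r c else min s (lruPotential H s r c + 1)

variable {H : Finset P} {s : ℕ} {r : P}

theorem lruPotential_le (c : List P) : lruPotential H s r c ≤ s := by
  induction c with
  | nil => exact le_rfl
  | cons x c ih =>
    rw [lruPotential]
    split_ifs <;> omega

theorem lruPotential_of_notMem {c : List P} (h : r ∉ c) : lruPotential H s r c = s := by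
  induction c with
  | nil => rfl
  | cons x c ih =>
    rw [List.mem_cons, not_or] at h
    rw [lruPotential, ih h.2, if_neg (Ne.symm h.1)]
    split_ifs <;> omega

theorem lruPotential_erase_le {x : P} (hx : x ≠ r) (c : List P) :
    lruPotential H s r (c.erase x) ≤ lruPotential H s r c := by
  induction c with
  | nil => exact le_rfl
  | cons y c ih =>
    have := lruPotential_le (H := H) (s := s) (r := r) c
    by_cases hy : y = x
    · subst hy
      rw [List.erase_cons_head, lruPotential, if_neg hx]
      split_ifs <;> omega
    · rw [List.erase_cons_tail (by simpa using hy), lruPotential, lruPotential]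
      split_ifs <;> omega

theorem lruPotential_append_of_mem {l₁ : List P} (l₂ : List P) (h : r ∈ l₁) :
    lruPotential H s r (l₁ ++ l₂) = lruPotential H s r l₁ := by
  induction l₁ with
  | nil => simp at h
  | cons y l ih =>
    rw [List.cons_append, lruPotential, lruPotential]
    by_cases hy : y = r
    · simp [hy]
    · rw [ih ((List.mem_cons.1 h).resolve_left (Ne.symm hy))]

theorem lruPotential_append_of_notMem {l₁ : List P} (l₂ : List P) (h : r ∉ l₁) :
    lruPotential H s r (l₁ ++ l₂) =
      min s (lruPotential H s r l₂ + l₁.countP (fun x => decide (x ∉ H))) := by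
  induction l₁ with
  | nil => simpa using lruPotential_le l₂
  | cons y l ih =>
    rw [List.mem_cons, not_or] at h
    rw [List.cons_append, lruPotential, ih h.2, if_neg (Ne.symm h.1), List.countP_cons]
    by_cases hy : y ∈ H
    · simp [hy]
    · simp only [hy, not_false_eq_true, decide_true, if_true, if_false]
      omega

/-- Eviction raises no potential: an evicted page is preceded by `k` distinct pages, at least `k -
H.card ≥ s` of them outside `H`, so its potential was already `s`. -/
theorem lruPotential_take_le {k : ℕ} {c : List P} (hc : c.Nodup) (hk : s + H.card ≤ k) :
    lruPotential H s r (c.take k) ≤ lruPotential H s r c := by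
  by_cases hr : r ∈ c.take k
  · have := lruPotential_append_of_mem (H := H) (s := s) (c.drop k) hr
    rw [List.take_append_drop] at this
    exact this.ge
  · rcases le_or_gt c.length k with hl | hl
    · rw [List.take_of_length_le hl]
    have := lruPotential_append_of_notMem (H := H) (s := s) (c.drop k) hr
    rw [List.take_append_drop] at this
    have h1 := List.length_eq_countP_add_countP (fun x => decide (x ∈ H)) (l := c.take k)
    have h2 : (c.take k).countP (fun x => decide (x ∈ H)) ≤ H.card := by
      rw [List.countP_eq_length_filter, ← List.toFinset_card_of_nodup
        (((List.take_sublist k c).nodup hc).filter _)]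
      refine Finset.card_le_card fun x hx => ?_
      simpa using (List.mem_filter.1 (List.mem_toFinset.1 hx)).2
    rw [List.length_take, min_eq_left hl.le] at h1
    simp only [decide_eq_true_eq] at h1
    rw [this, lruPotential_of_notMem hr]
    omega

/-- Amortization with fault price `s`. A request in `H` resets its own potential, which was `s` if
the page was missing, and raises no other. A request outside `H` raises each potential by at most
one, so with a fault it accounts for at most `H.card + s = k`. -/
theorem mul_lruFaults_le {k : ℕ} (hk : s + H.card = k) (c σ : List P) (hc : c.Nodup) :
    s * lruFaults k c σ ≤
      ∑ r ∈ H, lruPotential H s r c + k * σ.countP (fun x => decide (x ∉ H)) := by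
  induction σ generalizing c with
  | nil => simp [lruFaults]
  | cons x σ ih =>
    have hnd : (x :: c.erase x).Nodup := List.nodup_cons.2 ⟨hc.not_mem_erase, hc.erase x⟩
    have hstep := ih ((x :: c.erase x).take k) ((List.take_sublist _ _).nodup hnd)
    have hle (r : P) := lruPotential_take_le (r := r) hnd hk.le
    rw [lruFaults, List.countP_cons, mul_add]
    by_cases hx : x ∈ H
    · have hx0 : lruPotential H s x ((x :: c.erase x).take k) = 0 := by
        have := hle x
        rw [lruPotential, if_pos rfl] at this
        omega
      have hsum : ∑ r ∈ H, lruPotential H s r ((x :: c.erase x).take k) +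
          lruPotential H s x c ≤ ∑ r ∈ H, lruPotential H s r c := by
        rw [← Finset.sum_erase_add _ _ hx, ← Finset.sum_erase_add H (lruPotential H s · c) hx, hx0,
          add_zero]
        refine Nat.add_le_add_right (Finset.sum_le_sum fun r hr => ?_) _
        have hr' := (Finset.mem_erase.1 hr).1
        refine (hle r).trans ?_
        rw [lruPotential, if_neg hr'.symm, if_pos hx]
        exact lruPotential_erase_le hr'.symm c
      have hfault : s * (if x ∈ c then 0 else 1) ≤ lruPotential H s x c := by
        split_ifs with h
        · simp
        · rw [lruPotential_of_notMem h, mul_one]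
      simp only [hx, not_true_eq_false, decide_false, Bool.false_eq_true, if_false, add_zero]
      omega
    · have hsum : ∑ r ∈ H, lruPotential H s r ((x :: c.erase x).take k) ≤
          ∑ r ∈ H, lruPotential H s r c + H.card := by
        rw [Finset.card_eq_sum_ones, ← Finset.sum_add_distrib]
        refine Finset.sum_le_sum fun r hr => (hle r).trans ?_
        have hxr : x ≠ r := fun h => hx (h ▸ hr)
        have := lruPotential_erase_le (H := H) (s := s) hxr c
        rw [lruPotential, if_neg hxr, if_neg hx]
        omega
      have hfault : s * (if x ∈ c then 0 else 1) ≤ s := by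
        split_ifs <;> simp
      simp only [hx, not_false_eq_true, decide_true, if_true, mul_add, mul_one]
      omega

theorem countP_ofFn {Q : Type*} (p : Q → Prop) [DecidablePred p] {n : ℕ} (σ : Fin n → Q) :
    (List.ofFn σ).countP (fun x => decide (p x)) =
      (Finset.univ.filter fun t => p (σ t)).card := by
  rw [List.ofFn_eq_map, List.countP_map, List.countP_eq_length_filter]
  rfl

/-- Against any static set of at most half the cache size, LRU is 2-competitive. -/
theorem lruCost_le {k : ℕ} (hk : 1 ≤ k) (hH : 2 * H.card ≤ k) {n : ℕ} (σ : Fin n → P) :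
    lruCost k n σ ≤ H.card + 2 * (Finset.univ.filter fun t => σ t ∉ H).card := by
  have h := mul_lruFaults_le (H := H) (s := k - H.card) (k := k) (by omega) [] (List.ofFn σ)
    List.nodup_nil
  rw [countP_ofFn (fun x => x ∉ H)] at h
  simp only [lruPotential, Finset.sum_const, smul_eq_mul] at h
  -- With `s = k - H.card`, the hypothesis on `H` gives `k ≤ 2 * s`; the empty cache has potential
  -- `H.card * s`, so `s` cancels.
  set N := (Finset.univ.filter fun t => σ t ∉ H).card
  have h2 : k * N ≤ (k - H.card) * (2 * N) := by
    rw [← mul_assoc]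
    exact Nat.mul_le_mul_right _ (by omega)
  have h3 : (k - H.card) * lruFaults k [] (List.ofFn σ) ≤ (k - H.card) * (H.card + 2 * N) := by
    rw [mul_add, mul_comm _ H.card]
    omega
  exact Nat.le_of_mul_le_mul_left h3 (by omega)

end LRU

/-! ### Lower bound for the offline optimum. -/

section OPT

variable {P : Type*} [DecidableEq P]

theorem subset_union_biUnion_sdiff (C : ℕ → Finset P) {a b : ℕ} (hab : a ≤ b) :
    C b ⊆ C a ∪ (Finset.Ico a b).biUnion fun t => C (t + 1) \ C t := by
  induction b, hab using Nat.le_induction with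
  | base => simp
  | succ b hab ih =>
    intro x hx
    rw [Nat.Ico_succ_right_eq_insert_Ico hab, Finset.biUnion_insert]
    by_cases hb : x ∈ C b
    · have := ih hb
      simp only [Finset.mem_union] at this ⊢
      tauto
    · simp [hx, hb]

/-- The pages requested by `σ` at the times `a ≤ t < b`. -/
def requested {n : ℕ} (σ : Fin n → P) (a b : ℕ) : Finset P :=
  (Finset.univ.filter fun t : Fin n => a ≤ t ∧ (t : ℕ) < b).image σ

/-- Every page requested in the window is either among the at most `k` pages cached at its start or
is brought in during it. -/
theorem card_requested_le {k n : ℕ} {σ : Fin n → P} {C : ℕ → Finset P} (hC : IsSchedule k σ C)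
    (a b : ℕ) : (requested σ a b).card ≤ k + ∑ t ∈ Finset.Ico a b, (C (t + 1) \ C t).card := by
  have hsub : requested σ a b ⊆ C a ∪ (Finset.Ico a b).biUnion fun t => C (t + 1) \ C t := by
    intro x hx
    simp only [requested, Finset.mem_image, Finset.mem_filter, Finset.mem_univ, true_and] at hx
    obtain ⟨t, ⟨h1, h2⟩, rfl⟩ := hx
    refine Finset.union_subset_union_right (Finset.biUnion_subset_biUnion_of_subset_left _ ?_)
      (subset_union_biUnion_sdiff C (h1.trans (Nat.le_succ _)) (hC.2.2 t))
    exact Finset.Ico_subset_Ico_right h2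
  calc (requested σ a b).card ≤ _ := Finset.card_le_card hsub
    _ ≤ _ := Finset.card_union_le _ _
    _ ≤ _ := Nat.add_le_add (hC.2.1 a) Finset.card_biUnion_le

theorem sum_card_requested_le {k n : ℕ} {σ : Fin n → P} {C : ℕ → Finset P}
    (hC : IsSchedule k σ C) (w B : ℕ) :
    ∑ b ∈ Finset.range B, (requested σ (b * w) ((b + 1) * w)).card ≤
      B * k + ∑ t ∈ Finset.range (B * w), (C (t + 1) \ C t).card := by
  induction B with
  | zero => simp
  | succ B ih =>
    have h1 := card_requested_le hC (B * w) ((B + 1) * w)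
    have h2 := Finset.sum_range_add_sum_Ico (fun t => (C (t + 1) \ C t).card)
      (show B * w ≤ (B + 1) * w from Nat.mul_le_mul_right _ (Nat.le_succ B))
    rw [Finset.sum_range_succ, ← h2, show (B + 1) * k = B * k + k from Nat.succ_mul B k]
    omega

/-- Caching only the current page is feasible. Without a feasible schedule the infimum in `optCost`
would take the default value 0 and bound nothing. -/
theorem exists_isSchedule {Q : Type*} {k : ℕ} (hk : 1 ≤ k) {n : ℕ} (σ : Fin n → Q) :
    ∃ C : ℕ → Finset Q, IsSchedule k σ C := by
  refine ⟨fun t => if h : 1 ≤ t ∧ t - 1 < n then {σ ⟨t - 1, h.2⟩} else ∅, ?_, fun t => ?_,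
    fun t => ?_⟩
  · simp
  · dsimp only
    split_ifs <;> simp [hk]
  · simp

theorem sum_card_requested_le_optCost {k : ℕ} (hk : 1 ≤ k) {n : ℕ} (σ : Fin n → P) {w B : ℕ}
    (hB : B * w ≤ n) :
    ∑ b ∈ Finset.range B, (requested σ (b * w) ((b + 1) * w)).card ≤ B * k + optCost k n σ := by
  obtain ⟨C₀, hC₀⟩ := exists_isSchedule hk σ
  obtain ⟨C, hC, hcost⟩ := Nat.sInf_mem
    (s := {c : ℕ | ∃ C : ℕ → Finset P, IsSchedule k σ C ∧ scheduleCost n C = c}) ⟨_, C₀, hC₀, rfl⟩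
  rw [← optCost] at hcost
  refine (sum_card_requested_le hC w B).trans (Nat.add_le_add_left ?_ _)
  rw [← hcost, scheduleCost]
  exact Finset.sum_le_sum_of_subset (Finset.range_subset_range.2 hB)

end OPT

/-! ### The pages kept by Perfect LFU. -/

section LFU

variable {m : ℕ} {R : Type*} [LinearOrder R]

/-- If the page `i < k` is not among the `k` most frequent pages, then a later page is at least as
frequent. -/
theorem exists_lt_of_notMem_mostFrequent (w : Fin m → R) (τ : Equiv.Perm (Fin m)) {k : ℕ}
    {i : Fin m} (hik : (i : ℕ) < k) (hi : i ∉ mostFrequent w τ k) : ∃ j, i < j ∧ w i ≤ w j := by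
  by_contra! hcon
  refine hi (Finset.mem_filter.2 ⟨Finset.mem_univ _, lt_of_le_of_lt ?_ hik⟩)
  -- If all later pages are strictly less frequent, only the `i < k` earlier pages can rank ahead of
  -- `i`.
  rw [← Fin.card_Iio]
  refine Finset.card_le_card fun j hj => ?_
  rw [Finset.mem_Iio]
  rw [Finset.mem_filter] at hj
  by_contra! hle
  rcases hle.eq_or_lt with rfl | hlt
  · simp at hj
  · have := hcon j hlt
    rcases hj.2 with h | h
    · exact absurd h this.not_gt
    · exact this.ne' h.1

end LFU

end Paging

namespace Paging

/-! ### Expectations over independent requests. -/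

section Expectation

variable {m n : ℕ} {q : Fin m → ℝ}

/-- Expectation of a real function of `n` independent requests. -/
noncomputable def realExpectation (q : Fin m → ℝ) (n : ℕ) (f : (Fin n → Fin m) → ℝ) : ℝ :=
  ∑ σ : Fin n → Fin m, (∏ t, q (σ t)) * f σ

theorem expectation_eq_realExpectation (f : (Fin n → Fin m) → ℕ) :
    expectation q n f = realExpectation q n fun σ => (f σ : ℝ) := rfl

theorem realExpectation_mono (hq : ∀ i, 0 ≤ q i) {f g : (Fin n → Fin m) → ℝ}
    (h : ∀ σ, f σ ≤ g σ) : realExpectation q n f ≤ realExpectation q n g :=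
  Finset.sum_le_sum fun σ _ =>
    mul_le_mul_of_nonneg_left (h σ) (Finset.prod_nonneg fun t _ => hq (σ t))

theorem realExpectation_add (f g : (Fin n → Fin m) → ℝ) :
    realExpectation q n (fun σ => f σ + g σ) = realExpectation q n f + realExpectation q n g := by
  simp only [realExpectation, mul_add, Finset.sum_add_distrib]

theorem realExpectation_const_mul (c : ℝ) (f : (Fin n → Fin m) → ℝ) :
    realExpectation q n (fun σ => c * f σ) = c * realExpectation q n f := by
  simp only [realExpectation, Finset.mul_sum]
  exact Finset.sum_congr rfl fun σ _ => by ring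

theorem realExpectation_sum {ι : Type*} (s : Finset ι) (f : ι → (Fin n → Fin m) → ℝ) :
    realExpectation q n (fun σ => ∑ a ∈ s, f a σ) = ∑ a ∈ s, realExpectation q n (f a) := by
  simp only [realExpectation, Finset.mul_sum]
  exact Finset.sum_comm

/-- Independence; the exact probabilities and moments below are all obtained from this product
formula. -/
theorem realExpectation_prod (f : Fin n → Fin m → ℝ) :
    realExpectation q n (fun σ => ∏ t, f t (σ t)) = ∏ t, ∑ i, q i * f t i := by
  simp only [realExpectation, ← Finset.prod_mul_distrib]
  exact (Fintype.prod_sum fun t i => q i * f t i).symm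

theorem realExpectation_const (hq : ∑ i, q i = 1) (c : ℝ) :
    realExpectation q n (fun _ => c) = c := by
  have := realExpectation_prod (q := q) (n := n) fun _ _ => 1
  simp only [Finset.prod_const_one, mul_one, hq] at this
  have h := realExpectation_const_mul (q := q) c fun _ : Fin n → Fin m => (1 : ℝ)
  rwa [this, mul_one] at h

theorem realExpectation_request_mem (hq : ∑ i, q i = 1) (A : Finset (Fin m)) (s : Fin n) :
    realExpectation q n (fun σ => if σ s ∈ A then 1 else 0) = ∑ i ∈ A, q i := by
  have h := realExpectation_prod (q := q) (n := n)
    fun t i => if t = s then (if i ∈ A then 1 else 0) else 1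
  simp only [Finset.prod_ite_eq', Finset.mem_univ, if_true] at h
  rw [h, Finset.prod_eq_single s]
  · simp
  · intro t _ ht
    simp [ht, hq]
  · simp

theorem realExpectation_card_filter (p : Fin n → (Fin n → Fin m) → Prop)
    [∀ t σ, Decidable (p t σ)] :
    realExpectation q n (fun σ => ((Finset.univ.filter fun t => p t σ).card : ℝ)) =
      ∑ t, realExpectation q n (fun σ => if p t σ then 1 else 0) := by
  rw [← realExpectation_sum]
  congr 1
  ext σ
  rw [Finset.card_filter]
  push_cast
  rfl

theorem realExpectation_card_request_mem (hq : ∑ i, q i = 1) (A : Finset (Fin m)) :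
    realExpectation q n (fun σ => ((Finset.univ.filter fun t => σ t ∈ A).card : ℝ)) =
      n * ∑ i ∈ A, q i := by
  rw [realExpectation_card_filter]
  simp [realExpectation_request_mem hq]

theorem realExpectation_notMem_requested (hq : ∑ i, q i = 1) (i : Fin m) {a b : ℕ} (hb : b ≤ n) :
    realExpectation q n (fun σ => if i ∈ requested σ a b then 0 else 1) = (1 - q i) ^ (b - a) := by
  have h := realExpectation_prod (q := q) (n := n)
    fun t j => if a ≤ (t : ℕ) ∧ (t : ℕ) < b then (if j = i then 0 else 1) else 1
  have e (σ : Fin n → Fin m) : (if i ∈ requested σ a b then (0 : ℝ) else 1) =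
      ∏ t : Fin n, if a ≤ (t : ℕ) ∧ (t : ℕ) < b then (if σ t = i then 0 else 1) else 1 := by
    split_ifs with hi
    · simp only [requested, Finset.mem_image, Finset.mem_filter, Finset.mem_univ, true_and] at hi
      obtain ⟨t, ht, rfl⟩ := hi
      exact (Finset.prod_eq_zero (Finset.mem_univ t) (by simp [ht])).symm
    · refine (Finset.prod_eq_one fun t _ => ?_).symm
      split_ifs with h1 h2
      · exact absurd (Finset.mem_image.2 ⟨t, Finset.mem_filter.2 ⟨Finset.mem_univ _, h1⟩, h2⟩) hi
      · rfl
      · rfl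
  simp only [e]
  rw [h]
  have hsum (t : Fin n) : ∑ j, q j *
      (if a ≤ (t : ℕ) ∧ (t : ℕ) < b then (if j = i then (0 : ℝ) else 1) else 1) =
        if a ≤ (t : ℕ) ∧ (t : ℕ) < b then 1 - q i else 1 := by
    split_ifs with ht
    · rw [eq_sub_iff_add_eq, ← Finset.sum_erase_add _ _ (Finset.mem_univ i), if_pos rfl, mul_zero,
        add_zero]
      refine Eq.trans ?_ ((Finset.sum_erase_add Finset.univ q (Finset.mem_univ i)).trans hq)
      exact congrArg (· + q i)
        (Finset.sum_congr rfl fun j hj => by rw [if_neg (Finset.mem_erase.1 hj).1, mul_one])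
    · simp [hq]
  simp only [hsum]
  rw [Fin.prod_univ_eq_prod_range (fun t => if a ≤ t ∧ t < b then 1 - q i else 1) n,
    ← Finset.prod_filter, Finset.prod_const]
  congr 1
  rw [← Nat.card_Ico]
  congr 1
  ext t
  simp only [Finset.mem_filter, Finset.mem_range, Finset.mem_Ico]
  omega

/-- Expected number of different pages among `w` requests. -/
noncomputable def expectedDistinct (q : Fin m → ℝ) (w : ℕ) : ℝ :=
  ∑ i, (1 - (1 - q i) ^ w)

theorem realExpectation_card_requested (hq : ∑ i, q i = 1) {a b : ℕ} (hb : b ≤ n) :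
    realExpectation q n (fun σ => ((requested σ a b).card : ℝ)) =
      expectedDistinct q (b - a) := by
  have e (σ : Fin n → Fin m) : ((requested σ a b).card : ℝ) =
      m + ∑ i, (-1) * (if i ∈ requested σ a b then (0 : ℝ) else 1) := by
    have h1 : ((requested σ a b).card : ℝ) = ∑ i, if i ∈ requested σ a b then (1 : ℝ) else 0 := by
      simp
    have h2 : (m : ℝ) = ∑ _i : Fin m, 1 := by simp
    rw [h1, h2, ← Finset.sum_add_distrib]
    refine Finset.sum_congr rfl fun i _ => ?_
    split_ifs <;> norm_num
  simp only [e]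
  rw [realExpectation_add, realExpectation_const hq, realExpectation_sum]
  have e' (i : Fin m) :
      realExpectation q n (fun σ => (-1) * (if i ∈ requested σ a b then (0 : ℝ) else 1)) =
        -(1 - q i) ^ (b - a) := by
    rw [realExpectation_const_mul, realExpectation_notMem_requested hq _ hb, neg_one_mul]
  simp only [e', expectedDistinct, Finset.sum_sub_distrib, Finset.sum_const, Finset.card_univ,
    Fintype.card_fin, nsmul_eq_mul, mul_one, Finset.sum_neg_distrib]
  ring

/-- Disjoint windows of length `w` each contribute the expected number of distinct pages minus the
`k` pages possibly cached at the start. -/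
theorem le_expectation_optCost {k : ℕ} (hk : 1 ≤ k) (h0 : ∀ i, 0 ≤ q i) (hq : ∑ i, q i = 1)
    {w B : ℕ} (hB : B * w ≤ n) :
    B * (expectedDistinct q w - k) ≤ expectation q n (optCost k n) := by
  have h := realExpectation_mono (n := n) h0
    (f := fun σ => ∑ b ∈ Finset.range B, ((requested σ (b * w) ((b + 1) * w)).card : ℝ))
    (g := fun σ => (B * k : ℝ) + (optCost k n σ : ℝ))
    (fun σ => by exact_mod_cast sum_card_requested_le_optCost hk σ hB)
  rw [realExpectation_sum, realExpectation_add, realExpectation_const hq,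
    ← expectation_eq_realExpectation] at h
  have e : ∀ b ∈ Finset.range B, realExpectation q n
      (fun σ => ((requested σ (b * w) ((b + 1) * w)).card : ℝ)) = expectedDistinct q w := by
    intro b hb
    rw [realExpectation_card_requested hq]
    · congr 1
      rw [Nat.succ_mul, Nat.add_sub_cancel_left]
    · exact (Nat.mul_le_mul_right _ (Finset.mem_range.1 hb)).trans hB
  rw [Finset.sum_congr rfl e, Finset.sum_const, Finset.card_range, nsmul_eq_mul] at h
  linarith

theorem tendsto_expectedDistinct (h0 : ∀ i, 0 < q i) (h1 : ∀ i, q i ≤ 1) :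
    Filter.Tendsto (expectedDistinct q) Filter.atTop (nhds m) := by
  have h : Filter.Tendsto (fun w => ∑ i, (1 - (1 - q i) ^ w)) Filter.atTop
      (nhds (∑ _i : Fin m, (1 - 0))) := by
    refine tendsto_finsetSum _ fun i _ => tendsto_const_nhds.sub ?_
    exact tendsto_pow_atTop_nhds_zero_of_lt_one (sub_nonneg.2 (h1 i)) (sub_lt_self 1 (h0 i))
  rw [Finset.sum_const, sub_zero, Finset.card_univ, Fintype.card_fin, nsmul_one] at h
  exact h

/-- The probability that page `j` has been requested at least as often as the more probable
page `i` decays geometrically. -/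
theorem exists_realExpectation_countBefore_le (h0 : ∀ i, 0 < q i) (hq : ∑ i, q i = 1)
    {i j : Fin m} (hij : q j < q i) :
    ∃ ρ : ℝ, 0 ≤ ρ ∧ ρ < 1 ∧ ∀ (n : ℕ) (t : Fin n), realExpectation q n
      (fun σ => if countBefore σ t i ≤ countBefore σ t j then 1 else 0) ≤ ρ ^ (t : ℕ) := by
  have hne : i ≠ j := by
    rintro rfl
    exact lt_irrefl _ hij
  -- Chernoff bound: on the event, `z ^ (N_j - N_i) ≥ 1` for the two counts. Each earlier request
  -- multiplies its mean by `1 + (z - 1) * (z * q j - q i) / z`, which is below 1 exactly because `1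
  -- < z < q i / q j`.
  obtain ⟨z, hz1, hz2⟩ := exists_between ((one_lt_div (h0 j)).2 hij)
  have hz0 : 0 < z := by linarith
  rw [lt_div_iff₀ (h0 j)] at hz2
  let φ : Fin m → ℝ := fun l => (if l = j then z else 1) * (if l = i then z⁻¹ else 1)
  have hφ0 (l : Fin m) : 0 ≤ φ l := by
    simp only [φ]
    split_ifs <;> positivity
  have hφ : ∑ l, q l * φ l = 1 + (q j * (z - 1) + q i * (z⁻¹ - 1)) := by
    have e (l : Fin m) : q l * φ l = q l + ((if l = j then q l * (z - 1) else 0) +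
        (if l = i then q l * (z⁻¹ - 1) else 0)) := by
      simp only [φ]
      split_ifs with h1 h2
      · exact absurd (h2.symm.trans h1) hne
      all_goals ring
    simp only [e, Finset.sum_add_distrib, hq, Finset.sum_ite_eq', Finset.mem_univ, if_true]
  refine ⟨∑ l, q l * φ l, Finset.sum_nonneg fun l _ => mul_nonneg (h0 l).le (hφ0 l), ?_, ?_⟩
  · rw [hφ]
    have : q j * (z - 1) + q i * (z⁻¹ - 1) = (z - 1) * (z * q j - q i) / z := by
      field_simp
      ring
    rw [this]
    have : (z - 1) * (z * q j - q i) / z < 0 :=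
      div_neg_of_neg_of_pos (mul_neg_of_pos_of_neg (by linarith) (by linarith)) hz0
    linarith
  · intro n t
    have h := realExpectation_prod (q := q) (n := n) fun s l => if s < t then φ l else 1
    have hsum (s : Fin n) : ∑ l, q l * (if s < t then φ l else 1) =
        if s < t then ∑ l, q l * φ l else 1 := by
      split_ifs
      · rfl
      · simp [hq]
    simp only [hsum] at h
    rw [← Finset.prod_filter (fun s => s < t), Finset.prod_const,
      Finset.filter_gt_eq_Iio, Fin.card_Iio] at h
    rw [← h]
    refine realExpectation_mono (fun l => (h0 l).le) fun σ => ?_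
    split_ifs with hc
    · have c (l : Fin m) (y : ℝ) : ∏ s ∈ Finset.univ.filter (fun s => s < t),
          (if σ s = l then y else 1) = y ^ countBefore σ t l := by
        rw [← Finset.prod_filter, Finset.prod_const, Finset.filter_filter]
        rfl
      rw [← Finset.prod_filter (fun s => s < t), Finset.prod_mul_distrib, c, c, inv_pow,
        ← div_eq_mul_inv, one_le_div (by positivity)]
      exact pow_le_pow_right₀ hz1.le hc
    · refine Finset.prod_nonneg fun s _ => ?_
      split_ifs
      · exact hφ0 _
      · exact zero_le_one

end Expectation

/-! ### Upper bounds for the costs of LRU and PLFU. -/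

section Algorithms

variable {m : ℕ} {q : Fin m → ℝ}

/-- Total probability of the pages with index at least `h`. -/
noncomputable def tailMass (q : Fin m → ℝ) (h : ℕ) : ℝ :=
  ∑ i ∈ Finset.univ.filter fun i : Fin m => h ≤ i, q i

theorem tailMass_le_tailMass (h0 : ∀ i, 0 ≤ q i) {h k : ℕ} (hk : h ≤ k) :
    tailMass q k ≤ tailMass q h := by
  refine Finset.sum_le_sum_of_subset_of_nonneg ?_ fun i _ _ => h0 i
  intro i hi
  simp only [Finset.mem_filter, Finset.mem_univ, true_and] at hi ⊢
  exact hk.trans hi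

theorem realExpectation_card_tail {n : ℕ} (hq : ∑ i, q i = 1) (h : ℕ) :
    realExpectation q n
      (fun σ => ((Finset.univ.filter fun t => h ≤ ((σ t : Fin m) : ℕ)).card : ℝ)) =
        n * tailMass q h := by
  rw [tailMass, ← realExpectation_card_request_mem hq]
  simp only [Finset.mem_filter, Finset.mem_univ, true_and]

theorem expectation_lruCost_le {k : ℕ} (hk : 1 ≤ k) (h0 : ∀ i, 0 ≤ q i) (hq : ∑ i, q i = 1)
    (hm : k ≤ m) (n : ℕ) :
    expectation q n (lruCost k n) ≤ k + 2 * n * tailMass q (k / 2) := by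
  have hc : (Finset.univ.filter fun i : Fin m => (i : ℕ) < k / 2).card = k / 2 := by
    rw [Fin.card_filter_val_lt]
    omega
  have h := realExpectation_mono (n := n) h0 (f := fun σ => (lruCost k n σ : ℝ))
    (g := fun σ => (k : ℝ) +
      2 * ((Finset.univ.filter fun t => k / 2 ≤ ((σ t : Fin m) : ℕ)).card : ℝ))
    (fun σ => by
      have := lruCost_le (H := Finset.univ.filter fun i : Fin m => (i : ℕ) < k / 2) hk
        (by omega) σ
      simp only [hc, Finset.mem_filter, Finset.mem_univ, true_and, not_lt] at this
      exact_mod_cast this.trans (Nat.add_le_add_right (Nat.div_le_self k 2) _))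
  rw [realExpectation_add, realExpectation_const hq, realExpectation_const_mul,
    realExpectation_card_tail hq] at h
  rw [expectation_eq_realExpectation]
  linarith

theorem expectation_plfuCost_le (τ : Equiv.Perm (Fin m)) (k : ℕ) (h0 : ∀ i, 0 ≤ q i)
    (hq : ∑ i, q i = 1) (hanti : StrictAnti q) (n : ℕ) :
    expectation q n (plfuCost q τ k n) ≤ 2 * n * tailMass q k := by
  have h := realExpectation_mono (n := n) h0 (f := fun σ => (plfuCost q τ k n σ : ℝ))
    (g := fun σ => 2 * ((Finset.univ.filter fun t => k ≤ ((σ t : Fin m) : ℕ)).card : ℝ))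
    (fun σ => by
      have : (Finset.univ.filter fun t => σ t ∉ mostFrequent q τ k).card ≤
          (Finset.univ.filter fun t => k ≤ ((σ t : Fin m) : ℕ)).card := by
        refine Finset.card_le_card fun t ht => ?_
        simp only [Finset.mem_filter, Finset.mem_univ, true_and] at ht ⊢
        by_contra! hlt
        obtain ⟨j, hj, hle⟩ := exists_lt_of_notMem_mostFrequent q τ hlt ht
        exact absurd (hanti hj) hle.not_gt
      rw [plfuCost]
      exact_mod_cast Nat.mul_le_mul_left 2 this)
  rw [realExpectation_const_mul, realExpectation_card_tail hq] at h
  rw [expectation_eq_realExpectation]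
  linarith

/-- A fault on a page of index below `k` means that some less probable page has been requested at
least as often. For each pair this has geometrically decaying probability, so such faults contribute
a constant independent of `n`. -/
theorem exists_expectation_countingPlfuCost_le (τ : Equiv.Perm (Fin m)) (k : ℕ)
    (h0 : ∀ i, 0 < q i) (hq : ∑ i, q i = 1) (hanti : StrictAnti q) :
    ∃ A : ℝ, ∀ n : ℕ, expectation q n (countingPlfuCost τ k n) ≤ A + 2 * n * tailMass q k := by
  have hex (i j : Fin m) : ∃ A : ℝ, i < j → ∀ n : ℕ, realExpectation q n (fun σ =>
      ((Finset.univ.filter fun t => countBefore σ t i ≤ countBefore σ t j).card : ℝ)) ≤ A := by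
    by_cases hij : i < j
    · obtain ⟨ρ, hρ0, hρ1, hρ⟩ := exists_realExpectation_countBefore_le h0 hq (hanti hij)
      refine ⟨(1 - ρ)⁻¹, fun _ n => ?_⟩
      rw [realExpectation_card_filter]
      refine (Finset.sum_le_sum fun t _ => hρ n t).trans ?_
      rw [Fin.sum_univ_eq_sum_range (fun t => ρ ^ t) n, ← tsum_geometric_of_lt_one hρ0 hρ1]
      exact (summable_geometric_of_lt_one hρ0 hρ1).sum_le_tsum _ fun t _ => pow_nonneg hρ0 t
    · exact ⟨0, fun h => absurd h hij⟩
  choose A hA using hex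
  let pairs : Finset (Fin m × Fin m) := Finset.univ.filter fun x => x.1 < x.2
  refine ⟨2 * ∑ x ∈ pairs, A x.1 x.2, fun n => ?_⟩
  have h := realExpectation_mono (n := n) (fun i => (h0 i).le)
    (f := fun σ => (countingPlfuCost τ k n σ : ℝ))
    (g := fun σ => 2 * (((Finset.univ.filter fun t => k ≤ ((σ t : Fin m) : ℕ)).card : ℝ) +
      ∑ x ∈ pairs, ((Finset.univ.filter fun t =>
        countBefore σ t x.1 ≤ countBefore σ t x.2).card : ℝ)))
    (fun σ => by
      have : (Finset.univ.filter fun t => σ t ∉ mostFrequent (countBefore σ t) τ k).card ≤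
          (Finset.univ.filter fun t => k ≤ ((σ t : Fin m) : ℕ)).card +
            ∑ x ∈ pairs, (Finset.univ.filter fun t =>
              countBefore σ t x.1 ≤ countBefore σ t x.2).card := by
        refine le_trans (Finset.card_le_card (t := (Finset.univ.filter fun t =>
          k ≤ ((σ t : Fin m) : ℕ)) ∪ pairs.biUnion fun x => Finset.univ.filter fun t =>
            countBefore σ t x.1 ≤ countBefore σ t x.2) fun t ht => ?_)
          ((Finset.card_union_le _ _).trans (Nat.add_le_add_left Finset.card_biUnion_le _))
        simp only [Finset.mem_filter, Finset.mem_univ, true_and, Finset.mem_union,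
          Finset.mem_biUnion, pairs] at ht ⊢
        by_contra! hcon
        obtain ⟨j, hj, hle⟩ := exists_lt_of_notMem_mostFrequent _ τ hcon.1 ht
        exact absurd (hcon.2 (σ t, j) hj) hle.not_gt
      rw [countingPlfuCost]
      exact_mod_cast Nat.mul_le_mul_left 2 this)
  rw [realExpectation_const_mul, realExpectation_add, realExpectation_card_tail hq,
    realExpectation_sum] at h
  have hs := Finset.sum_le_sum fun x (hx : x ∈ pairs) =>
    hA x.1 x.2 (Finset.mem_filter.1 hx).2 n
  rw [expectation_eq_realExpectation]
  linarith

end Algorithms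

/-! ### The window argument and the ratio of expectations. -/

section Ratio

variable {m k : ℕ} {q : Fin m → ℝ}

/-- A window of `w` requests in which `3k/2` different pages are expected, but in which only
`O(k)` requests to pages outside the top `k/2` are expected. -/
theorem exists_window (hk : 1 ≤ k) (hm : 2 * k ≤ m) (h0 : ∀ i, 0 < q i) (hq : ∑ i, q i = 1)
    (hanti : StrictAnti q) {K : ℝ} (hK : 0 ≤ K)
    (hKq : ∀ i j : Fin m, k / 2 ≤ (i : ℕ) → (i : ℕ) < 2 * k → (j : ℕ) + 1 = 2 * k →
      q i ≤ K * q j) :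
    ∃ w : ℕ, 1 ≤ w ∧ 3 / 2 * (k : ℝ) ≤ expectedDistinct q w ∧
      w * tailMass q (k / 2) ≤ (7 + 6 * K) * k := by
  classical
  have hk' : (1 : ℝ) ≤ k := by exact_mod_cast hk
  have hm' : 2 * (k : ℝ) ≤ m := by exact_mod_cast hm
  have h1 (i : Fin m) : q i ≤ 1 := by
    rw [← hq]
    exact Finset.single_le_sum (fun j _ => (h0 j).le) (Finset.mem_univ i)
  have hex : ∃ w, 3 / 2 * (k : ℝ) ≤ expectedDistinct q w :=
    ((tendsto_expectedDistinct h0 h1).eventually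
      (eventually_ge_nhds (by linarith : 3 / 2 * (k : ℝ) < m))).exists
  -- The shortest window has length `w + 1`; the estimates use that length `w` still falls short of
  -- `3k/2` expected distinct pages.
  obtain ⟨w, hw⟩ : ∃ w, Nat.find hex = w + 1 := by
    refine Nat.exists_eq_succ_of_ne_zero fun h => ?_
    have := Nat.find_spec hex
    rw [h] at this
    simp only [expectedDistinct, pow_zero, sub_self, Finset.sum_const_zero] at this
    linarith
  have hspec := Nat.find_spec hex
  have hlt := Nat.find_min hex (m := w) (by omega)
  rw [hw] at hspec
  rw [not_le] at hlt
  refine ⟨w + 1, by omega, hspec, ?_⟩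
  have hnn (i : Fin m) : 0 ≤ 1 - (1 - q i) ^ w :=
    sub_nonneg.2 (pow_le_one₀ (sub_nonneg.2 (h1 i)) (sub_le_self 1 (h0 i).le))
  let j : Fin m := ⟨2 * k - 1, by omega⟩
  have hj : (j : ℕ) + 1 = 2 * k := by simp only [j]; omega
  have hcard : (Finset.univ.filter fun i : Fin m => (i : ℕ) < 2 * k).card = 2 * k := by
    rw [Fin.card_filter_val_lt]
    omega
  -- The first `2k` pages are at least as likely as `j`, so `2k * (1 - (1 - q j) ^ w) < 3k/2`. Hence
  -- `w * q j / (1 + w * q j) ≤ 3/4`.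
  have hwj : w * q j ≤ 3 := by
    have hle : (2 * k : ℝ) * (1 - (1 - q j) ^ w) ≤ expectedDistinct q w := by
      calc (2 * k : ℝ) * (1 - (1 - q j) ^ w)
          = ∑ i ∈ Finset.univ.filter fun i : Fin m => (i : ℕ) < 2 * k, (1 - (1 - q j) ^ w) := by
            rw [Finset.sum_const, hcard, nsmul_eq_mul]
            push_cast
            rfl
        _ ≤ ∑ i ∈ Finset.univ.filter fun i : Fin m => (i : ℕ) < 2 * k, (1 - (1 - q i) ^ w) := by
            refine Finset.sum_le_sum fun i hi => ?_
            have hij : q j ≤ q i := by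
              refine hanti.antitone (Fin.le_def.2 ?_)
              have := (Finset.mem_filter.1 hi).2
              omega
            have := pow_le_pow_left₀ (sub_nonneg.2 (h1 i))
              (by linarith : 1 - q i ≤ 1 - q j) w
            linarith
        _ ≤ _ := Finset.sum_le_sum_of_subset_of_nonneg (Finset.subset_univ _)
            fun i _ _ => hnn i
    have hfrac := mul_div_one_add_mul_le_one_sub_one_sub_pow w (h0 j).le (h1 j)
    have h34 : 1 - (1 - q j) ^ w ≤ 3 / 4 := by
      by_contra! hcon
      nlinarith
    have hpos : 0 < 1 + w * q j := by
      have := mul_nonneg (Nat.cast_nonneg (α := ℝ) w) (h0 j).le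
      linarith
    have := (div_le_iff₀ hpos).1 (hfrac.trans h34)
    linarith
  have hnear : w * ∑ i ∈ Finset.univ.filter fun i : Fin m => k / 2 ≤ (i : ℕ) ∧ (i : ℕ) < 2 * k,
      q i ≤ 2 * k * (3 * K) := by
    rw [Finset.mul_sum]
    calc ∑ i ∈ Finset.univ.filter fun i : Fin m => k / 2 ≤ (i : ℕ) ∧ (i : ℕ) < 2 * k, w * q i
        ≤ (Finset.univ.filter fun i : Fin m => k / 2 ≤ (i : ℕ) ∧ (i : ℕ) < 2 * k).card •
            (3 * K) := by
          refine Finset.sum_le_card_nsmul _ _ _ fun i hi => ?_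
          have hi' := (Finset.mem_filter.1 hi).2
          calc (w : ℝ) * q i ≤ w * (K * q j) :=
                mul_le_mul_of_nonneg_left (hKq i j hi'.1 hi'.2 hj) (Nat.cast_nonneg w)
            _ = w * q j * K := by ring
            _ ≤ 3 * K := mul_le_mul_of_nonneg_right hwj hK
      _ ≤ _ := by
          rw [nsmul_eq_mul]
          refine mul_le_mul_of_nonneg_right ?_ (by positivity)
          have := Finset.card_le_card (s := Finset.univ.filter fun i : Fin m =>
            k / 2 ≤ (i : ℕ) ∧ (i : ℕ) < 2 * k) (t := Finset.univ.filter fun i : Fin m =>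
              (i : ℕ) < 2 * k) (Finset.monotone_filter_right _ fun i _ hi => hi.2)
          rw [hcard] at this
          exact_mod_cast this
  -- Beyond page `2k` one has `w * q i ≤ 3`, so `w * q i` is at most 4 times the probability of
  -- seeing page `i`; the total is at most `4 * (3k/2)`.
  have hfar : w * ∑ i ∈ Finset.univ.filter fun i : Fin m => 2 * k ≤ (i : ℕ), q i ≤ 6 * k := by
    have : w * ∑ i ∈ Finset.univ.filter fun i : Fin m => 2 * k ≤ (i : ℕ), q i ≤
        4 * expectedDistinct q w := by
      rw [Finset.mul_sum, expectedDistinct, Finset.mul_sum]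
      refine (Finset.sum_le_sum fun i hi => ?_).trans (Finset.sum_le_sum_of_subset_of_nonneg
        (Finset.subset_univ _) fun i _ _ => mul_nonneg (by norm_num) (hnn i))
      have hi' := (Finset.mem_filter.1 hi).2
      have hij : q i ≤ q j := hanti.antitone (Fin.le_def.2 (by omega))
      have hwi : w * q i ≤ 3 :=
        (mul_le_mul_of_nonneg_left hij (Nat.cast_nonneg w)).trans hwj
      have hwi0 : 0 ≤ w * q i := mul_nonneg (Nat.cast_nonneg w) (h0 i).le
      have hfrac := mul_div_one_add_mul_le_one_sub_one_sub_pow w (h0 i).le (h1 i)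
      have : w * q i / 4 ≤ w * q i / (1 + w * q i) :=
        div_le_div_of_nonneg_left hwi0 (by linarith) (by linarith)
      linarith
    linarith
  have hsplit : tailMass q (k / 2) =
      ∑ i ∈ Finset.univ.filter (fun i : Fin m => k / 2 ≤ (i : ℕ) ∧ (i : ℕ) < 2 * k), q i +
        ∑ i ∈ Finset.univ.filter (fun i : Fin m => 2 * k ≤ (i : ℕ)), q i := by
    rw [tailMass, ← Finset.sum_filter_add_sum_filter_not _ (fun i : Fin m => (i : ℕ) < 2 * k),
      Finset.filter_filter, Finset.filter_filter]
    congr 2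
    ext i
    simp only [Finset.mem_filter, Finset.mem_univ, true_and]
    omega
  -- The last request of the window adds at most `1 ≤ k`, which turns `6 + 6 * K` into `7 + 6 * K`.
  have hT : tailMass q (k / 2) ≤ 1 := by
    rw [← hq]
    exact Finset.sum_le_sum_of_subset_of_nonneg (Finset.subset_univ _) fun i _ _ => (h0 i).le
  push_cast
  rw [add_mul, one_mul]
  rw [hsplit] at hT ⊢
  rw [mul_add]
  linarith

theorem RoE_le (hk : 1 ≤ k) (hm : 2 * k ≤ m) (h0 : ∀ i, 0 < q i) (hq : ∑ i, q i = 1)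
    (hanti : StrictAnti q) {K : ℝ} (hK : 0 ≤ K)
    (hKq : ∀ i j : Fin m, k / 2 ≤ (i : ℕ) → (i : ℕ) < 2 * k → (j : ℕ) + 1 = 2 * k →
      q i ≤ K * q j) {ALG : ∀ n : ℕ, (Fin n → Fin m) → ℕ} {A : ℝ}
    (hALG : ∀ n : ℕ, expectation q n (ALG n) ≤ A + 2 * n * tailMass q (k / 2)) :
    RoE q k ALG ≤ ENNReal.ofReal (4 * (7 + 6 * K) + 1) := by
  obtain ⟨w, hw1, hw2, hw3⟩ := exists_window hk hm h0 hq hanti hK hKq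
  have hk' : (1 : ℝ) ≤ k := by exact_mod_cast hk
  have hw' : (1 : ℝ) ≤ w := by exact_mod_cast hw1
  set U := tailMass q (k / 2) with hU
  have hUpos : 0 < U := Finset.sum_pos (fun i _ => h0 i)
    ⟨⟨k / 2, by omega⟩, Finset.mem_filter.2 ⟨Finset.mem_univ _, le_rfl⟩⟩
  set C := 7 + 6 * K with hC
  have hCpos : 0 < C := by positivity
  -- Each of the `⌊n / w⌋` full windows costs at least `3k/2 - k = k/2`, and `hw3` bounds `U` by `C
  -- * k / w`.
  have hOPT (n : ℕ) : n * U / (2 * C) - k / 2 ≤ expectation q n (optCost k n) := by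
    have h := le_expectation_optCost hk (fun i => (h0 i).le) hq (Nat.div_mul_le_self n w)
    have hB : (n : ℝ) / w - 1 ≤ (n / w : ℕ) := by
      rw [sub_le_iff_le_add, div_le_iff₀ (by linarith)]
      have h1 : n ≤ (n / w + 1) * w := by
        have := Nat.div_add_mod n w
        have := Nat.mod_lt n (show w > 0 by omega)
        nlinarith
      exact_mod_cast h1
    have h2 : (n / w : ℕ) * (k / 2 : ℝ) ≤ (n / w : ℕ) * (expectedDistinct q w - k) :=
      mul_le_mul_of_nonneg_left (by linarith) (Nat.cast_nonneg _)
    have h3 := mul_le_mul_of_nonneg_right hB (by positivity : (0 : ℝ) ≤ k / 2)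
    have h4 : n * U / (2 * C) ≤ n / w * (k / 2) := by
      rw [div_mul_div_comm, div_le_div_iff₀ (by positivity) (by positivity)]
      have := mul_le_mul_of_nonneg_left hw3 (by positivity : (0 : ℝ) ≤ 2 * n)
      linarith
    linarith
  refine Filter.limsup_le_of_le (by isBoundedDefault) ?_
  have hlim : Filter.Tendsto (fun n : ℕ => (n : ℝ) * (U / (2 * C))) Filter.atTop Filter.atTop :=
    tendsto_natCast_atTop_atTop.atTop_mul_const (by positivity)
  -- The ratio `4 * C` already covers `2nU`; the extra 1 gives slack `n * U / (2 * C)`, which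
  -- eventually absorbs all additive constants.
  filter_upwards [hlim.eventually_ge_atTop (A + (4 * C + 1) * (k / 2))] with n hn
  refine ENNReal.div_le_of_le_mul ?_
  rw [← ENNReal.ofReal_mul (by positivity)]
  refine ENNReal.ofReal_le_ofReal ((hALG n).trans ?_)
  have h1 := mul_le_mul_of_nonneg_left (hOPT n) (by positivity : 0 ≤ 4 * C + 1)
  have h2 : (4 * C + 1) * (n * U / (2 * C) - k / 2) =
      2 * n * U + n * (U / (2 * C)) - (4 * C + 1) * (k / 2) := by
    field_simp
    ring
  linarith

end Ratio

/-! ### The multi-core law on `Fin m`. -/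

section MultiCoreDist

variable {α : ℝ} {m κ : ℕ}

theorem multiCoreDist_pos (hα : 0 < α) (hm : 1 ≤ m) (hκ : 1 ≤ κ) (i : Fin m) :
    0 < multiCoreDist α m κ i :=
  multiCore_pos hα hm hκ (Nat.le_add_left 1 i)

theorem strictAnti_multiCoreDist (hα : 0 < α) (hm : 1 ≤ m) (hκ : 1 ≤ κ) :
    StrictAnti (multiCoreDist α m κ) := fun i _ hij =>
  multiCore_lt_multiCore hα hm hκ (Nat.le_add_left 1 i) (Nat.add_lt_add_right hij 1)

theorem sum_multiCoreDist (hα : 0 < α) (hm : 1 ≤ m) (hκ : 1 ≤ κ) :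
    ∑ i, multiCoreDist α m κ i = 1 := by
  rw [← sum_multiCore hα hm hκ]
  unfold multiCoreDist
  rw [Fin.sum_univ_eq_sum_range (fun i => multiCore α m κ (i + 1)) m, Finset.range_eq_Ico,
    Finset.sum_Ico_add' (fun i => multiCore α m κ i) 0 m 1]
  rfl

theorem multiCoreDist_le_rpow_mul (hα : 0 < α) (hm : 1 ≤ m) (hκ : 1 ≤ κ) {k : ℕ} (i j : Fin m)
    (hi : k / 2 ≤ (i : ℕ)) (hik : (i : ℕ) < 2 * k) (hj : (j : ℕ) + 1 = 2 * k) :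
    multiCoreDist α m κ i ≤ 4 ^ α * multiCoreDist α m κ j := by
  refine multiCore_le_rpow_mul hα hm hκ (Nat.le_add_left 1 i) (by omega) ?_
  -- Index `i` is page `i + 1`, which exceeds `k/2`; this shift keeps the constant 4 valid for odd
  -- `k`.
  exact_mod_cast (by omega : (j : ℕ) + 1 ≤ 4 * ((i : ℕ) + 1))

end MultiCoreDist

end Paging

theorem mainTheorem6 :
    (∀ (κ : ℕ) (x : ℝ), 1 ≤ κ → 0 ≤ x → x ≤ 1 / (κ : ℝ) →
      κ * x ≥ 1 - (1 - x) ^ κ ∧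
      1 - (1 - x) ^ κ ≥ κ * x / (1 + κ * x) ∧
      κ * x / (1 + κ * x) ≥ κ * x / 2) ∧
    ∀ α : ℝ, 0 < α →
      (∀ k m κ : ℕ, 1 ≤ k → 2 * k ≤ m → 1 ≤ κ →
        Paging.minExpr (Paging.multiCore α m κ) k m ≥
          Paging.minExpr (Paging.powerLaw α m) k m * (1 / 2)) ∧
      (∃ δ : ℝ, 0 < δ ∧ ∀ k m κ : ℕ, 1 ≤ k → 2 * k ≤ m → 1 ≤ κ →
        δ ≤ Paging.minExpr (Paging.multiCore α m κ) k m) ∧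
      ∃ c : ℝ≥0, ∀ k m κ : ℕ, 1 ≤ k → 2 * k ≤ m → 1 ≤ κ →
        Paging.RoE (Paging.multiCoreDist α m κ) k (Paging.lruCost k) ≤ (c : ℝ≥0∞) ∧
        ∀ τ : Equiv.Perm (Fin m),
          Paging.RoE (Paging.multiCoreDist α m κ) k
            (Paging.plfuCost (Paging.multiCoreDist α m κ) τ k) ≤ (c : ℝ≥0∞) ∧
          Paging.RoE (Paging.multiCoreDist α m κ) k
            (Paging.countingPlfuCost τ k) ≤ (c : ℝ≥0∞) := by
  refine ⟨Paging.one_sub_one_sub_pow_bounds, fun α hα => ⟨?_, ?_, ?_⟩⟩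
  · intro k m κ hk hm hκ
    have hm1 : 1 ≤ m := by omega
    have h1 := Paging.half_tailRatio_le_minExpr hk hm
      (fun i hi => Paging.multiCore_pos hα hm1 hκ hi)
      (fun i j hi hij => Paging.multiCore_le_multiCore hα hm1 hκ hi hij)
    have h2 := Paging.tailRatio_le_tailRatio hk hm (fun i hi => Paging.powerLaw_pos α hm1 hi)
      (fun i hi => Paging.multiCore_pos hα hm1 hκ hi)
      (fun i j hi hij => Paging.multiCore_mul_powerLaw_le hα hm1 hκ hi hij)
    -- For the power law only the trivial bound of the minimum by its second argument is needed.
    have h3 : Paging.minExpr (Paging.powerLaw α m) k m ≤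
        Paging.tailRatio (Paging.powerLaw α m) k m := min_le_right _ _
    linarith
  · refine ⟨1 / (1 + 4 * 4 ^ α) / 2, by positivity, fun k m κ hk hm hκ => ?_⟩
    have hm1 : 1 ≤ m := by omega
    have hpos (i : ℕ) (hi : 1 ≤ i) := Paging.multiCore_pos hα hm1 hκ hi
    have hanti (i j : ℕ) (hi : 1 ≤ i) (hij : i ≤ j) :=
      Paging.multiCore_le_multiCore hα hm1 hκ hi hij
    have h1 := Paging.half_tailRatio_le_minExpr hk hm hpos hanti
    have h2 := Paging.inv_le_tailRatio hk hm (K := 4 ^ α) hpos hanti fun i hi hik =>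
      Paging.multiCore_le_rpow_mul hα hm1 hκ (by omega) hik
        (by exact_mod_cast (by omega : 2 * k ≤ 4 * i))
    linarith
  · refine ⟨(4 * (7 + 6 * 4 ^ α) + 1 : ℝ).toNNReal, fun k m κ hk hm hκ => ?_⟩
    have hm1 : 1 ≤ m := by omega
    have h0 := Paging.multiCoreDist_pos hα hm1 hκ
    have h0' (i : Fin m) := (h0 i).le
    have hq := Paging.sum_multiCoreDist hα hm1 hκ
    have hanti := Paging.strictAnti_multiCoreDist hα hm1 hκ
    have hR {ALG : ∀ n : ℕ, (Fin n → Fin m) → ℕ} {A : ℝ} := Paging.RoE_le (ALG := ALG) (A := A)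
      hk hm h0 hq hanti (by positivity : (0 : ℝ) ≤ 4 ^ α)
      (fun i j => Paging.multiCoreDist_le_rpow_mul hα hm1 hκ i j)
    have hT (n : ℕ) := mul_le_mul_of_nonneg_left
      (Paging.tailMass_le_tailMass h0' (Nat.div_le_self k 2)) (by positivity : (0 : ℝ) ≤ 2 * n)
    refine ⟨hR (Paging.expectation_lruCost_le hk h0' hq (by omega)), fun τ => ⟨?_, ?_⟩⟩
    · refine hR (A := 0) fun n => ?_
      have := Paging.expectation_plfuCost_le τ k h0' hq hanti n
      linarith [hT n]
    · obtain ⟨A, hA⟩ := Paging.exists_expectation_countingPlfuCost_le τ k h0 hq hanti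
      exact hR (A := A) fun n => (hA n).trans (by linarith [hT n])
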